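/- **Conventions.** A subset $A$ of a standard Borel space $X$ is *analytic* ($\boldsymbol\Sigma^1_1$) if it is the projection to $X$ of a Borel subset of $X\times Y$ for some Polish space $Y$. A quasi-order (reflexive transitive relation) $R$ on a standard Borel space $X$ is analytic if it is an analytic subset of $X^2$. If $P,R$ are quasi-orders on standard Borel spaces $Z,X$, a *Borel reduction* of $P$ to $R$ is a Borel map $f:Z\to X$ such that $z\mathrel P z' \iff f(z)\mathrel R f(z')$ for all $z,z'\in Z$. An analytic quasi-order $R$ is *complete* if every analytic quasi-order on every standard Borel space has a Borel reduction to $R$. A *quandle* is a set $Q$ with a binary operation $*$ such that $x*(y*z)=(x*y)*(x*z)$ and $x*x=x$ for all $x,y,z\in Q$, and such that for all $x,z\in Q$ there is a unique $y\in Q$ with $x*y=z$. Let $X_{Qdl}$ be the space of quandles with domain $\mathbb N$, a Borel subset of $2^{\mathbb N^3}$ (a quandle being identified with the characteristic function of the graph of its operation), and let $P\sqsubseteq_{Qdl}Q$ mean that there is an injective quandle homomorphism $P\to Q$. Let $X_{CT^{\sqcup}}$ be the space of connected acyclic graphs $T$ (combinatorial trees) with vertex set $\mathbb N$ such that for every $x$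 there is $y\neq x$ with $(x,y)\notin T$ (no complete vertices), a Borel subset of $2^{\mathbb N^2}$, and let $S\sqsubseteq_{CT^{\sqcup}}T$ mean that there is an injection $f:\mathbb N\to\mathbb N$ with $(n,m)\in S\iff(f(n),f(m))\in T$ for all $n,m$. For a graph $T$ on $\mathbb N$, let $Q_T$ be the quandle with underlying set $\mathbb N\times\{0,1\}$ and operation $$(u,i)*_T(v,j)=\begin{cases}(v,j)&\text{if }u=v\text{ or }(u,v)\in T,\\(v,j-1)&\text{otherwise,}\end{cases}$$ where $j-1$ is computed modulo $2$. For a bijection $e:\mathbb N\times\{0,1\}\to\mathbb N$ (for example $e(n,i)=2n+i$), let $\mathcal Q^e_T$ be the quandle with domain $\mathbb N$ to which $e$ is an isomorphism from $Q_T$. **Theorem.** 1. The relation $\sqsubseteq_{Qdl}$ of embeddability on the space $X_{Qdl}$ of countable quandles is a complete analytic quasi-order. 2. For all $S,T\in X_{CT^{\sqcup}}$, $S\sqsubseteq_{CT^{\sqcup}}T$ if and only if there is an injective quandle homomorphism $Q_S\to Q_T$. Moreover, for every bijection $e:\mathbb N\times\{0,1\}\to\mathbb N$, the map $X_{CT^{\sqcup}}\to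 X_{Qdl}$, $T\mapsto\mathcal Q^e_T$, is a Borel reduction of $\sqsubseteq_{CT^{\sqcup}}$ to $\sqsubseteq_{Qdl}$. -/

import Mathlib

open MeasureTheory

/-! ### Analytic quasi-orders and Borel reducibility -/

/-- A subset `A` of a standard Borel space `X` is *analytic* if it is the projection to `X` of a
Borel subset of `X × Y`, for some Polish space `Y`. -/
def IsAnalyticSubset {X : Type*} [MeasurableSpace X] (A : Set X) : Prop :=
  ∃ (Y : Type) (_ : TopologicalSpace Y) (_ : PolishSpace Y) (_ : MeasurableSpace Y)
    (_ : BorelSpace Y) (B : Set (X × Y)), MeasurableSet B ∧ A = Prod.fst '' B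

/-- An *analytic quasi-order* on a standard Borel space: a reflexive and transitive relation that is
an analytic subset of the square. -/
structure IsAnalyticQuasiOrder {X : Type*} [MeasurableSpace X] [StandardBorelSpace X]
    (R : X → X → Prop) : Prop where
  refl : ∀ x, R x x
  trans : ∀ x y z, R x y → R y z → R x z
  analytic : IsAnalyticSubset {p : X × X | R p.1 p.2}

/-- `f` is a *Borel reduction* of the relation `P` to the relation `R`. -/
structure IsBorelReduction {X Y : Type*} [MeasurableSpace X] [StandardBorelSpace X]
    [MeasurableSpace Y] [StandardBorelSpace Y]
    (f : X → Y) (P : X → X → Prop) (R : Y → Y → Prop) : Prop where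
  measurable : Measurable f
  iff : ∀ x y, P x y ↔ R (f x) (f y)

universe u v

/-- A *complete analytic quasi-order*: an analytic quasi-order on a standard Borel space to which
every analytic quasi-order on every standard Borel space is Borel reducible. -/
structure IsCompleteAnalyticQuasiOrder {X : Type v} [MeasurableSpace X] [StandardBorelSpace X]
    (R : X → X → Prop) : Prop where
  isAnalyticQuasiOrder : IsAnalyticQuasiOrder R
  complete : ∀ (Z : Type u) [MeasurableSpace Z] [StandardBorelSpace Z] (P : Z → Z → Prop),
    IsAnalyticQuasiOrder P → ∃ f : Z → X, IsBorelReduction f P R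

theorem standardBorelSpace_comap {α β : Type*} [mβ : MeasurableSpace β] [StandardBorelSpace β]
    (f : α → β) (hf : Function.Injective f) (hr : MeasurableSet (Set.range f)) :
    @StandardBorelSpace α (MeasurableSpace.comap f mβ) := by
  let _ : MeasurableSpace α := MeasurableSpace.comap f mβ
  have he : MeasurableEmbedding f := by
    refine ⟨hf, comap_measurable f, ?_⟩
    rintro _ ⟨t, ht, rfl⟩
    rw [Set.image_preimage_eq_inter_range]
    exact ht.inter hr
  have := hr.standardBorel
  let := upgradeStandardBorel (Set.range f)
  let e := he.equivRange
  let tα : TopologicalSpace α := TopologicalSpace.induced e inferInstance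
  have hi : Topology.IsInducing e := ⟨rfl⟩
  have : PolishSpace α := (e.toEquiv.toHomeomorphOfIsInducing hi).isClosedEmbedding.polishSpace
  have : BorelSpace α := ⟨by
    rw [borel_comap, ← BorelSpace.measurable_eq (α := Set.range f)]
    exact e.measurableEmbedding.comap_eq.symm⟩
  infer_instance

/-! ### The space of countable quandles -/

/-- The space of quandles with domain `ℕ`. -/
def QuandleSpace : Type := Quandle ℕ

/-- The characteristic function of the graph of the quandle operation, a point of `2^(ℕ³)`. -/
def QuandleSpace.code (Q : QuandleSpace) : ℕ → ℕ → ℕ → Prop :=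
  fun x y z => Shelf.act (self := Q.toShelf) x y = z

/-- The Borel structure of the space of quandles, as a subspace of `2^(ℕ³)`. -/
instance : MeasurableSpace QuandleSpace := MeasurableSpace.comap QuandleSpace.code inferInstance

theorem QuandleSpace.code_injective : Function.Injective QuandleSpace.code := by
  intro P Q h
  have hact : ∀ x y, Shelf.act (self := P.toShelf) x y = Shelf.act (self := Q.toShelf) x y := by
    intro x y
    have := congrFun (congrFun (congrFun h x) y) (Shelf.act (self := Q.toShelf) x y)
    simp only [code, eq_iff_iff, iff_true] at this
    exact this
  have hinv : ∀ x y, Rack.invAct (self := P.toRack) x y = Rack.invAct (self := Q.toRack) x y := by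
    intro x y
    have h1 := Rack.left_inv (self := Q.toRack) x (Rack.invAct (self := P.toRack) x y)
    rw [← hact, Rack.right_inv (self := P.toRack) x y] at h1
    exact h1.symm
  cases P with | @mk P' _ => cases P' with | @mk P'' i _ _ => cases P'' with | @mk a _ =>
  cases Q with | @mk Q' _ => cases Q' with | @mk Q'' j _ _ => cases Q'' with | @mk b _ =>
  obtain rfl := funext₂ hact
  obtain rfl := funext₂ hinv
  rfl

theorem QuandleSpace.range_code : Set.range QuandleSpace.code =
    {c | (∀ x y, ∃ z, c x y z) ∧ (∀ x y z w, c x y z → c x y w → z = w) ∧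
      (∀ x z, ∃ y, c x y z) ∧ (∀ x y z w, c x y z → c x w z → y = w) ∧ (∀ x, c x x x) ∧
      ∀ x y z a b d e, c y z a → c x a b → c x y d → c x z e → c d e b} := by
  ext c
  constructor
  · rintro ⟨Q, rfl⟩
    refine ⟨fun x y => ⟨_, rfl⟩, ?_, fun x z => ⟨_, Rack.right_inv (self := Q.toRack) x z⟩, ?_,
      fun x => Quandle.fix (self := Q), ?_⟩
    · rintro x y z w rfl h
      exact h
    · rintro x y z w rfl h
      exact ((Rack.left_inv (self := Q.toRack) x).injective h).symm
    · rintro x y z a b d e rfl rfl rfl rfl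
      exact (Shelf.self_distrib (self := Q.toShelf)).symm
  · rintro ⟨h1, h2, h3, h4, h5, h6⟩
    choose f hf using h1
    choose g hg using h3
    refine ⟨({ act := f, self_distrib := ?_, invAct := g, left_inv := ?_, right_inv := ?_,
               fix := ?_ } : Quandle ℕ), ?_⟩
    · intro x y z
      exact h2 _ _ _ _ (h6 x y z _ _ _ _ (hf _ _) (hf _ _) (hf _ _) (hf _ _)) (hf _ _) |>.symm ▸ rfl
    · intro x y
      exact h4 _ _ _ _ (hg _ _) (hf _ _)
    · intro x y
      exact h2 _ _ _ _ (hf _ _) (hg _ _)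
    · intro x
      exact h2 _ _ _ _ (hf _ _) (h5 _)
    · funext x y z
      refine propext ⟨?_, fun h => h2 _ _ _ _ (hf _ _) h⟩
      rintro rfl
      exact hf x y

theorem QuandleSpace.measurableSet_range_code : MeasurableSet (Set.range QuandleSpace.code) := by
  rw [range_code, measurableSet_setOfPred]
  fun_prop

instance : StandardBorelSpace QuandleSpace :=
  standardBorelSpace_comap _ QuandleSpace.code_injective QuandleSpace.measurableSet_range_code

/-- The quandle `A` embeds into the quandle `B`: there is an injective homomorphism. -/
def QuandleEmbeds (A B : Type*) [Quandle A] [Quandle B] : Prop :=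
  ∃ f : ShelfHom A B, Function.Injective f

/-- Embeddability on the space of countable quandles. -/
def QuandleSpace.Embeds (P Q : QuandleSpace) : Prop :=
  @QuandleEmbeds ℕ ℕ P Q

/-! ### Combinatorial trees without complete vertices -/

/-- The space of combinatorial trees with vertex set `ℕ` in which no vertex is adjacent to all the
other vertices. Its Borel structure is that of a subspace of `SimpleGraph ℕ`, which in turn has the
Borel structure induced from `2^(ℕ²)` by the adjacency relation. -/
def TreeSpace : Type :=
  {T : SimpleGraph ℕ // T.IsTree ∧ ∀ x, ∃ y, x ≠ y ∧ ¬ T.Adj x y}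

instance : MeasurableSpace TreeSpace :=
  inferInstanceAs (MeasurableSpace {T : SimpleGraph ℕ // T.IsTree ∧ ∀ x, ∃ y, x ≠ y ∧ ¬ T.Adj x y})

theorem standardBorelSpace_simpleGraph : StandardBorelSpace (SimpleGraph ℕ) := by
  refine standardBorelSpace_comap SimpleGraph.Adj (fun G H h => SimpleGraph.ext h) ?_
  have : Set.range (SimpleGraph.Adj (V := ℕ)) =
      {c | (∀ x y, c x y → c y x) ∧ ∀ x, ¬ c x x} := by
    ext c
    constructor
    · rintro ⟨G, rfl⟩
      exact ⟨fun x y h => h.symm, fun x => G.irrefl⟩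
    · rintro ⟨h1, h2⟩
      exact ⟨⟨c, ⟨fun x y h => h1 x y h⟩, ⟨h2⟩⟩, rfl⟩
  rw [this, measurableSet_setOfPred]
  fun_prop

theorem measurable_reachable {Ω : Type*} [MeasurableSpace Ω] (G : Ω → SimpleGraph ℕ)
    (hG : Measurable G) (x y : ℕ) : Measurable fun ω => (G ω).Reachable x y := by
  have key : ∀ (n : ℕ) (x y : ℕ), Measurable fun ω => ∃ p : (G ω).Walk x y, p.length = n := by
    intro n
    induction n with
    | zero =>
      intro x y
      have : (fun ω => ∃ p : (G ω).Walk x y, p.length = 0) = fun _ => x = y := by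
        funext ω
        refine propext ⟨fun ⟨p, hp⟩ => SimpleGraph.Walk.eq_of_length_eq_zero hp, ?_⟩
        rintro rfl
        exact ⟨.nil, rfl⟩
      rw [this]
      exact measurable_const
    | succ n ih =>
      intro x y
      have : (fun ω => ∃ p : (G ω).Walk x y, p.length = n + 1) =
          fun ω => ∃ z, (G ω).Adj x z ∧ ∃ p : (G ω).Walk z y, p.length = n := by
        funext ω
        refine propext ⟨?_, ?_⟩
        · rintro ⟨p, hp⟩
          cases p with
          | nil => simp at hp
          | cons h q => exact ⟨_, h, q, by simpa using hp⟩
        · rintro ⟨z, h, q, hq⟩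
          exact ⟨.cons h q, by simp [hq]⟩
      rw [this]
      exact .exists fun z => .and (SimpleGraph.measurable_iff_adj.1 hG x z) (ih z y)
  have : (fun ω => (G ω).Reachable x y) = fun ω => ∃ n, ∃ p : (G ω).Walk x y, p.length = n := by
    funext ω
    exact propext ⟨fun ⟨p⟩ => ⟨_, p, rfl⟩, fun ⟨_, p, _⟩ => ⟨p⟩⟩
  rw [this]
  exact .exists fun n => key n x y

theorem measurableSet_tree :
    MeasurableSet {T : SimpleGraph ℕ | T.IsTree ∧ ∀ x, ∃ y, x ≠ y ∧ ¬ T.Adj x y} := by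
  rw [measurableSet_setOfPred]
  simp only [SimpleGraph.isTree_iff, SimpleGraph.connected_iff, SimpleGraph.Preconnected,
    SimpleGraph.isAcyclic_iff_forall_adj_isBridge, SimpleGraph.isBridge_iff]
  have hadj : ∀ x y, Measurable fun T : SimpleGraph ℕ => T.Adj x y :=
    SimpleGraph.measurable_iff_adj.1 measurable_id
  have hdel : ∀ v w, Measurable fun T : SimpleGraph ℕ => T.deleteEdges {s(v, w)} := by
    intro v w
    refine SimpleGraph.measurable_iff_adj.2 fun a b => ?_
    simp only [SimpleGraph.deleteEdges_adj]
    exact .and (hadj a b) measurable_const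
  refine .and (.and (.and ?_ measurable_const) ?_) ?_
  · exact .forall fun x => .forall fun y => measurable_reachable _ measurable_id x y
  · exact .forall fun v => .forall fun w => .imp (hadj v w)
      (measurable_reachable _ (hdel v w) v w).not
  · exact .forall fun x => .exists fun y => .and measurable_const (hadj x y).not

instance : StandardBorelSpace TreeSpace :=
  have := standardBorelSpace_simpleGraph
  measurableSet_tree.standardBorel

/-- Embeddability on the space of combinatorial trees without complete vertices: the graph `S` is
isomorphic to the subgraph of `T` induced on the image of an injection of the vertices. -/
def TreeSpace.Embeds (S T : TreeSpace) : Prop :=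
  Nonempty (S.1 ↪g T.1)

/-! ### The quandle of a graph -/

/-- The underlying set `ℕ × {0, 1}` of the quandle of a graph. -/
def GraphQuandle (_T : SimpleGraph ℕ) : Type := ℕ × Fin 2

open Classical in
/-- The operation of the quandle of a graph. -/
noncomputable def GraphQuandle.op (T : SimpleGraph ℕ) : ℕ × Fin 2 → ℕ × Fin 2 → ℕ × Fin 2 :=
  fun p q => if p.1 = q.1 ∨ T.Adj p.1 q.1 then (q.1, q.2) else (q.1, q.2 - 1)

theorem GraphQuandle.op_op (T : SimpleGraph ℕ) (p q : ℕ × Fin 2) :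
    op T p (op T p q) = q := by
  obtain ⟨v, j⟩ := q
  by_cases h : p.1 = v ∨ T.Adj p.1 v
  · simp [op, h]
  · simp only [op, h, if_false, Prod.mk.injEq, true_and]
    fin_cases j <;> rfl

theorem GraphQuandle.op_self (T : SimpleGraph ℕ) (p : ℕ × Fin 2) : op T p p = p := by
  simp [op]

theorem GraphQuandle.op_distrib (T : SimpleGraph ℕ) (p q r : ℕ × Fin 2) :
    op T p (op T q r) = op T (op T p q) (op T p r) := by
  obtain ⟨u, i⟩ := p
  obtain ⟨v, j⟩ := q
  obtain ⟨w, k⟩ := r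
  by_cases h1 : v = w ∨ T.Adj v w <;> by_cases h2 : u = w ∨ T.Adj u w <;>
    by_cases h3 : u = v ∨ T.Adj u v <;> simp [op, h1, h2, h3]

noncomputable instance (T : SimpleGraph ℕ) : Quandle (GraphQuandle T) where
  act := GraphQuandle.op T
  self_distrib := GraphQuandle.op_distrib T _ _ _
  invAct := GraphQuandle.op T
  left_inv := GraphQuandle.op_op T
  right_inv := GraphQuandle.op_op T
  fix := GraphQuandle.op_self T _

/-- The quandle structure on `B` transported from `A` along a bijection. -/
@[reducible]
def transportQuandle {A B : Type*} [Quandle A] (e : A ≃ B) : Quandle B where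
  act x y := e (Shelf.act (e.symm x) (e.symm y))
  self_distrib := by
    intro x y z
    simp only [Equiv.symm_apply_apply]
    rw [Shelf.self_distrib]
  invAct x y := e (Rack.invAct (e.symm x) (e.symm y))
  left_inv := by intro x y; simp
  right_inv := by intro x y; simp
  fix := by intro x; simp

/-- The copy with domain `ℕ` of the quandle of the graph `T`, coded by the bijection `e`. -/
noncomputable def codedGraphQuandle (e : ℕ × Fin 2 ≃ ℕ) (T : SimpleGraph ℕ) : QuandleSpace :=
  transportQuandle (A := GraphQuandle T) e

/-!
The second part rests on the fibres `{v} × {0, 1}` of a graph quandle. If no vertex is complete, then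
the two points of the fibre over `v` are exchanged by any point over a vertex that is not adjacent to
`v`, so an injective homomorphism maps fibres onto fibres and induces an injection of the vertices;
this injection preserves and reflects adjacency because `p * q = q` says exactly that the vertices of
`p` and `q` are equal or adjacent (`quandleEmbeds_graphQuandle_iff`).

For the completeness, the pairs in `V × V` are labelled by positive integers `N(u, v)`, with `1` on
the diagonal only, and `V × ℚ/ℤ` becomes a quandle by `(u, a) * (v, b) = (v, b + 1 / N(u, v))`. The
action of a point over `u` on a point over `v` runs through a cycle of length `N(u, v)`, so injective
homomorphisms between such quandles amount to label-preserving maps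
(`PairLabelling.quandleEmbeds_iff`).

Let `R` be an analytic quasi-order. After a measurable injection of the space into `2^ℕ`, its graph
is the range of a continuous `g : ℕ^ℕ → 2^ℕ × 2^ℕ`. For a point `x`, the vertices are the level `n`
approximations of finite chains of `R`-related points (with their `g`-witnesses) that end at `x`, and
the labels record the levels, the starting points, and whether one approximation restricts to the
other. If `x R y`, then appending a link from `x` to `y` to every chain is a label-preserving map
(`exists_map_of_rangeRel`). Conversely, a label-preserving map sends the empty chains at the initial
segments of `x` to a coherent sequence of approximations of chains from `x` to `y`; as `g` is
continuous, their limit is a chain from `x` to `y`, and `x R y` by transitivity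
(`reflTransGen_of_map`). Keeping the whole chain as part of a vertex is what makes the approximations
composable, although approximations of single links are not.
-/

/-! ### Embeddings between copies with domain `ℕ` -/

theorem QuandleSpace.embeds_transport_iff {A B : Type*} [Quandle A] [Quandle B] (e : A ≃ ℕ)
    (e' : B ≃ ℕ) :
    QuandleSpace.Embeds (transportQuandle e) (transportQuandle e') ↔ QuandleEmbeds A B := by
  constructor
  · rintro ⟨⟨f, hf⟩, hinj⟩
    refine ⟨⟨fun a => e'.symm (f (e a)), fun {a b} => ?_⟩,
      e'.symm.injective.comp (hinj.comp e.injective)⟩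
    have h := @hf (e a) (e b)
    change f (e (Shelf.act (e.symm (e a)) (e.symm (e b)))) =
      e' (Shelf.act (e'.symm (f (e a))) (e'.symm (f (e b)))) at h
    rw [e.symm_apply_apply, e.symm_apply_apply] at h
    rw [h, e'.symm_apply_apply]
  · rintro ⟨⟨f, hf⟩, hinj⟩
    refine ⟨@ShelfHom.mk ℕ ℕ (transportQuandle e).toShelf (transportQuandle e').toShelf
      (fun a => e' (f (e.symm a))) fun {a b} => ?_,
      e'.injective.comp (hinj.comp e.symm.injective)⟩
    change e' (f (e.symm (e (Shelf.act (e.symm a) (e.symm b))))) =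
      e' (Shelf.act (e'.symm (e' (f (e.symm a)))) (e'.symm (e' (f (e.symm b)))))
    rw [e.symm_apply_apply, e'.symm_apply_apply, e'.symm_apply_apply, hf]

theorem QuandleSpace.measurable_iff_code {Ω : Type*} [MeasurableSpace Ω] {F : Ω → QuandleSpace} :
    Measurable F ↔ ∀ x y z, Measurable fun ω => (F ω).code x y z := by
  rw [measurable_comap_iff]
  simp only [measurable_pi_iff, Function.comp_apply]

/-! ### Embeddability of countable quandles is an analytic quasi-order -/

theorem QuandleSpace.embeds_iff_code (P Q : QuandleSpace) :
    P.Embeds Q ↔ ∃ f : ℕ → ℕ, (∀ a b, f a = f b → a = b) ∧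
      ∀ a b c, P.code a b c → Q.code (f a) (f b) (f c) := by
  constructor
  · rintro ⟨⟨f, hf⟩, hinj⟩
    refine ⟨f, fun a b h => hinj h, ?_⟩
    rintro a b c rfl
    exact hf.symm
  · rintro ⟨f, hf, h⟩
    exact ⟨@ShelfHom.mk ℕ ℕ P.toShelf Q.toShelf f fun {a b} => (h a b _ rfl).symm,
      fun a b => hf a b⟩

theorem QuandleSpace.isAnalyticQuasiOrder_embeds : IsAnalyticQuasiOrder QuandleSpace.Embeds where
  refl P := (embeds_iff_code P P).2 ⟨id, fun _ _ => id, fun _ _ _ => id⟩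
  trans P Q R h h' := by
    obtain ⟨f, hf, hP⟩ := (embeds_iff_code P Q).1 h
    obtain ⟨g, hg, hQ⟩ := (embeds_iff_code Q R).1 h'
    exact (embeds_iff_code P R).2 ⟨g ∘ f, fun a b hab => hf _ _ (hg _ _ hab),
      fun a b c hc => hQ _ _ _ (hP _ _ _ hc)⟩
  analytic := by
    refine ⟨ℕ → ℕ, inferInstance, inferInstance, inferInstance, inferInstance,
      {q | (∀ a b, q.2 a = q.2 b → a = b) ∧
        ∀ a b c, q.1.1.code a b c → q.1.2.code (q.2 a) (q.2 b) (q.2 c)}, ?_, ?_⟩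
    · have hcode : ∀ a b c, Measurable fun Q : QuandleSpace => Q.code a b c :=
        measurable_iff_code.1 measurable_id
      have hval : ∀ a i : ℕ,
          Measurable fun q : (QuandleSpace × QuandleSpace) × (ℕ → ℕ) => q.2 a = i :=
        fun a i => (measurable_of_countable fun m : ℕ => m = i).comp
          ((measurable_pi_apply a).comp measurable_snd)
      have heval : ∀ a b c, Measurable fun q : (QuandleSpace × QuandleSpace) × (ℕ → ℕ) =>
          q.1.2.code (q.2 a) (q.2 b) (q.2 c) := by
        intro a b c
        have : (fun q : (QuandleSpace × QuandleSpace) × (ℕ → ℕ) =>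
            q.1.2.code (q.2 a) (q.2 b) (q.2 c)) =
            fun q => ∃ i j k, q.2 a = i ∧ q.2 b = j ∧ q.2 c = k ∧ q.1.2.code i j k := by
          funext q
          simp
        rw [this]
        exact .exists fun i => .exists fun j => .exists fun k => .and (hval a i)
          (.and (hval b j) (.and (hval c k) ((hcode i j k).comp (by fun_prop))))
      rw [measurableSet_setOfPred]
      refine .and (.forall fun a => .forall fun b => .imp ?_ measurable_const)
        (.forall fun a => .forall fun b => .forall fun c => .imp
          ((hcode a b c).comp (by fun_prop)) (heval a b c))
      have hpair : Measurable fun q : (QuandleSpace × QuandleSpace) × (ℕ → ℕ) =>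
          (q.2 a, q.2 b) := by fun_prop
      exact (measurable_of_countable fun m : ℕ × ℕ => m.1 = m.2).comp hpair
    · ext ⟨P, Q⟩
      simp [embeds_iff_code]

/-! ### Quandles of labelled complete digraphs -/

/-- A labelling of the ordered pairs of elements of `V` by positive integers, in which the label `1`
marks exactly the diagonal. -/
structure PairLabelling (V : Type*) where
  label : V → V → ℕ
  label_pos : ∀ u v, 0 < label u v
  label_eq_one_iff : ∀ u v, label u v = 1 ↔ u = v

/-- The underlying set `V × ℚ/ℤ` of the quandle of a labelling. -/
def LabelQuandle {V : Type*} (_N : PairLabelling V) : Type _ := V × AddCircle (1 : ℚ)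

namespace PairLabelling

variable {V W : Type*}

/-- The element `1 / N(u, v)` of `ℚ/ℤ`, by which points over `u` translate the fibre over `v`. -/
noncomputable def shift (N : PairLabelling V) (u v : V) : AddCircle (1 : ℚ) :=
  ((1 / (N.label u v : ℚ) : ℚ) : AddCircle (1 : ℚ))

theorem addOrderOf_shift (N : PairLabelling V) (u v : V) :
    addOrderOf (N.shift u v) = N.label u v :=
  AddCircle.addOrderOf_period_div (N.label_pos u v)

theorem shift_self (N : PairLabelling V) (u : V) : N.shift u u = 0 := by
  rw [← AddMonoid.addOrderOf_eq_one_iff, addOrderOf_shift, N.label_eq_one_iff]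

noncomputable instance (N : PairLabelling V) : Quandle (LabelQuandle N) where
  act p q := (q.1, q.2 + N.shift p.1 q.1)
  self_distrib := Prod.ext rfl (add_right_comm _ _ _)
  invAct p q := (q.1, q.2 - N.shift p.1 q.1)
  left_inv _ _ := Prod.ext rfl (add_sub_cancel_right _ _)
  right_inv _ _ := Prod.ext rfl (sub_add_cancel _ _)
  fix {p} := Prod.ext rfl (by rw [shift_self, add_zero])

/-- Injective homomorphisms between quandles of labellings amount to label-preserving maps: iterating
the action of a point over `u` on a point over `v` runs through a cycle of length `N(u, v)`, and
injective homomorphisms preserve the lengths of such cycles. -/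
theorem quandleEmbeds_iff (N : PairLabelling V) (M : PairLabelling W) :
    QuandleEmbeds (LabelQuandle N) (LabelQuandle M) ↔
      ∃ γ : V → W, ∀ u v, M.label (γ u) (γ v) = N.label u v := by
  constructor
  · rintro ⟨⟨f, hf⟩, hinj⟩
    let f' : V × AddCircle (1 : ℚ) → W × AddCircle (1 : ℚ) := f
    have hf' : ∀ p q, f' (q.1, q.2 + N.shift p.1 q.1) =
        ((f' q).1, (f' q).2 + M.shift (f' p).1 (f' q).1) := fun p q => @hf p q
    have hinj' : Function.Injective f' := hinj
    refine ⟨fun v => (f' (v, 0)).1, fun u v => ?_⟩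
    have key : ∀ m : ℕ, f' (v, m • N.shift u v) =
        ((f' (v, 0)).1, (f' (v, 0)).2 + m • M.shift (f' (u, 0)).1 (f' (v, 0)).1) := by
      intro m
      induction m with
      | zero => simp
      | succ m ih =>
        have h := hf' (u, 0) (v, m • N.shift u v)
        rw [ih] at h
        rw [succ_nsmul, succ_nsmul, ← add_assoc]
        exact h
    rw [← M.addOrderOf_shift, ← N.addOrderOf_shift, addOrderOf_eq_addOrderOf_iff]
    intro m
    constructor
    · intro h
      have heq : f' (v, m • N.shift u v) = f' (v, 0) := by
        rw [key]
        exact Prod.ext rfl (by rw [h, add_zero])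
      exact congrArg Prod.snd (hinj' heq)
    · intro h
      have h2 := congrArg Prod.snd (key m)
      rw [h] at h2
      simpa using h2
  · rintro ⟨γ, hγ⟩
    refine ⟨⟨fun p => (γ p.1, p.2), fun {p q} => Prod.ext rfl ?_⟩, ?_⟩
    · change q.2 + N.shift p.1 q.1 = q.2 + M.shift (γ p.1) (γ q.1)
      simp only [shift, hγ]
    · rintro ⟨u, a⟩ ⟨v, b⟩ h
      have h1 : γ u = γ v := congrArg Prod.fst h
      have h2 : a = b := congrArg Prod.snd h
      rw [← M.label_eq_one_iff, hγ, N.label_eq_one_iff] at h1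
      rw [h1, h2]

end PairLabelling

/-! ### Initial segments of sequences -/

/-- The first `n` values of a sequence. -/
def initSeg {α : Type*} (n : ℕ) (x : ℕ → α) : List α := (List.range n).map x

theorem initSeg_succ {α : Type*} (n : ℕ) (x : ℕ → α) :
    initSeg (n + 1) x = initSeg n x ++ [x n] := by
  simp [initSeg, List.range_succ]

theorem initSeg_eq_iff {α : Type*} {n : ℕ} {x y : ℕ → α} :
    initSeg n x = initSeg n y ↔ ∀ i < n, x i = y i := by
  simp [initSeg, List.map_inj_left]

theorem take_initSeg {α : Type*} {m n : ℕ} (h : m ≤ n) (x : ℕ → α) :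
    (initSeg n x).take m = initSeg m x := by
  rw [initSeg, initSeg, ← List.map_take, List.take_range, min_eq_left h]

theorem exists_eq_initSeg {α : Type*} {s : ℕ → List α} (hs : ∀ n, ∃ x, initSeg n x = s n)
    (hcoh : ∀ n, (s (n + 1)).take n = s n) : ∃ x, ∀ n, s n = initSeg n x := by
  choose b hb using hs
  refine ⟨fun i => b (i + 1) i, fun n => ?_⟩
  induction n with
  | zero => rw [← hb]; rfl
  | succ n ih =>
    rw [initSeg_succ, ← ih, ← hcoh n, ← hb (n + 1), take_initSeg n.le_succ, initSeg_succ]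

theorem eq_of_forall_initSeg {α : Type*} {x y : ℕ → α} (h : ∀ n, initSeg n x = initSeg n y) :
    x = y :=
  funext fun i => initSeg_eq_iff.1 (h (i + 1)) i i.lt_succ_self

theorem tendsto_of_initSeg {α : Type*} [TopologicalSpace α] {b : ℕ → ℕ → α} {x : ℕ → α}
    (h : ∀ n, initSeg n (b n) = initSeg n x) : Filter.Tendsto b Filter.atTop (nhds x) := by
  refine tendsto_pi_nhds.2 fun i => tendsto_const_nhds.congr' ?_
  filter_upwards [Filter.eventually_gt_atTop i] with n hn
  exact (initSeg_eq_iff.1 (h n) i hn).symm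

theorem measurable_initSeg {Z : Type*} [MeasurableSpace Z] {c : Z → ℕ → Bool} (hc : Measurable c)
    (n : ℕ) (P : List Bool → Prop) : Measurable fun z => P (initSeg n (c z)) := by
  induction n generalizing P with
  | zero => exact measurable_const (a := P [])
  | succ n ih =>
    have hval : ∀ b, Measurable fun z => c z n = b := fun b =>
      (measurable_of_countable fun m : Bool => m = b).comp ((measurable_pi_apply n).comp hc)
    have : (fun z => P (initSeg (n + 1) (c z))) =
        fun z => ∃ b, c z n = b ∧ P (initSeg n (c z) ++ [b]) := by
      funext z
      simp [initSeg_succ]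
    rw [this]
    exact .exists fun b => .and (hval b) (ih fun w => P (w ++ [b]))

/-! ### Approximations to chains of related points -/

section Chain

variable (g : (ℕ → ℕ) → (ℕ → Bool) × (ℕ → Bool))

/-- The relation on `2^ℕ` whose graph is the range of `g`; the preimages under `g` of a pair are the
witnesses that its members are related. -/
def RangeRel (x y : ℕ → Bool) : Prop := ∃ β, g β = (x, y)

/-- `IsApproxChain g n u l v` says that `l` is a level `n` approximation of a chain of links of
`RangeRel g` from `u` to `v`: the entries of `l` are pairs consisting of the first `n` values of a
witness of a link, and of the first `n` values of its endpoint. Different links may be realized by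
witnesses whose endpoints agree only in their first `n` values. -/
def IsApproxChain (n : ℕ) : List Bool → List (List ℕ × List Bool) → List Bool → Prop
  | u, [], v => u = v
  | u, a :: l, v => (∃ β, initSeg n β = a.1 ∧ initSeg n (g β).1 = u ∧ initSeg n (g β).2 = a.2) ∧
      IsApproxChain n a.2 l v

variable {g}

theorem IsApproxChain.append_link {n : ℕ} {u : List Bool} {l : List (List ℕ × List Bool)}
    {β : ℕ → ℕ} {x y : ℕ → Bool} (hβ : g β = (x, y)) (h : IsApproxChain g n u l (initSeg n x)) :
    IsApproxChain g n u (l ++ [(initSeg n β, initSeg n y)]) (initSeg n y) := by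
  induction l generalizing u with
  | nil => exact ⟨⟨β, rfl, by rw [hβ]; exact Eq.symm h, by rw [hβ]⟩, rfl⟩
  | cons a l ih => exact ⟨h.1, ih h.2⟩

/-- The restriction to level `n` of an approximation to a chain. -/
def truncate (n : ℕ) (l : List (List ℕ × List Bool)) : List (List ℕ × List Bool) :=
  l.map fun a => (a.1.take n, a.2.take n)

/-- A coherent sequence of approximations to chains has as its limit a chain, because the graph of
the continuous map `g` is closed. -/
theorem reflTransGen_of_approxChains (hg : Continuous g) {y : ℕ → Bool} (k : ℕ) (x : ℕ → Bool)
    (L : ℕ → List (List ℕ × List Bool)) (hlen : ∀ n, (L n).length = k)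
    (hcoh : ∀ n, truncate n (L (n + 1)) = L n)
    (hL : ∀ n, IsApproxChain g n (initSeg n x) (L n) (initSeg n y)) :
    Relation.ReflTransGen (RangeRel g) x y := by
  induction k generalizing x L with
  | zero =>
    have h0 : ∀ n, L n = [] := fun n => List.eq_nil_of_length_eq_zero (hlen n)
    have : x = y := eq_of_forall_initSeg fun n => by
      have := hL n
      rw [h0 n] at this
      exact this
    rw [this]
  | succ k ih =>
    choose a L' haL using fun n => List.exists_cons_of_length_eq_add_one (hlen n)
    simp only [haL, truncate, List.map_cons, List.cons.injEq] at hcoh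
    simp only [haL, IsApproxChain] at hL
    choose b hb1 hb2 hb3 using fun n => (hL n).1
    obtain ⟨β, hβ⟩ := exists_eq_initSeg (s := fun n => (a n).1) (fun n => ⟨_, hb1 n⟩)
      fun n => congrArg Prod.fst (hcoh n).1
    obtain ⟨w, hw⟩ := exists_eq_initSeg (s := fun n => (a n).2) (fun n => ⟨_, hb3 n⟩)
      fun n => congrArg Prod.snd (hcoh n).1
    have hbβ : Filter.Tendsto b Filter.atTop (nhds β) :=
      tendsto_of_initSeg fun n => (hb1 n).trans (hβ n)
    have hgb := (hg.tendsto β).comp hbβ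
    have h1 : (g β).1 = x := tendsto_nhds_unique ((continuous_fst.tendsto _).comp hgb)
      (tendsto_of_initSeg hb2)
    have h2 : (g β).2 = w := tendsto_nhds_unique ((continuous_snd.tendsto _).comp hgb)
      (tendsto_of_initSeg fun n => (hb3 n).trans (hw n))
    refine .head ⟨β, Prod.ext h1 h2⟩ (ih w L' (fun n => ?_) (fun n => (hcoh n).2) fun n => ?_)
    · have := hlen n
      rw [haL] at this
      simpa using this
    · rw [← hw n]
      exact (hL n).2

/-! ### The labelling attached to a point -/

/-- The vertices `(n, u, l)`, to be read as an approximation `l` at level `n` to a chain that starts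
at `u`, together with an infinite reserve of vertices that are present at no point. -/
abbrev ChainVertex : Type := ℕ × List Bool × List (List ℕ × List Bool) ⊕ ℕ

variable (g) in
/-- A vertex is present at `x` if it is an approximation to a chain that ends at `x`. -/
def IsPresent (x : ℕ → Bool) : ChainVertex → Prop
  | .inl p => IsApproxChain g p.1 p.2.1 p.2.2 (initSeg p.1 x)
  | .inr _ => False

open Classical in
/-- A code for the levels and the starting points of two vertices, and for the truth value of the
statement that the first is the restriction of the second to its level. -/
noncomputable def pairCode : ChainVertex → ChainVertex → ℕ
  | .inl p, .inl q => Encodable.encode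
      ((p.1, p.2.1), (q.1, q.2.1), decide (p.1 ≤ q.1 ∧ truncate p.1 q.2.2 = p.2.2))
  | _, _ => 0

open Classical in
/-- The labelling of pairs of vertices by their codes, where only the vertices satisfying `P` take
part: every other vertex is joined to all vertices but itself by the label `2`. The offset `3` keeps
the codes apart from `2` and from the diagonal label `1`. -/
noncomputable def chainLabelling (P : ChainVertex → Prop) : PairLabelling ChainVertex where
  label u v := if u = v then 1 else if P u ∧ P v then pairCode u v + 3 else 2
  label_pos u v := by split_ifs <;> omega
  label_eq_one_iff u v := by
    split_ifs with h <;> simp [h]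

/-- The effect on vertices of appending to every chain a link with witness `β` and endpoint `y`. -/
def appendLink (β : ℕ → ℕ) (y : ℕ → Bool) (p : ℕ × List Bool × List (List ℕ × List Bool)) :
    ℕ × List Bool × List (List ℕ × List Bool) :=
  (p.1, p.2.1, p.2.2 ++ [(initSeg p.1 β, initSeg p.1 y)])

theorem appendLink_injective (β : ℕ → ℕ) (y : ℕ → Bool) :
    Function.Injective (appendLink β y) := by
  rintro ⟨n, u, l⟩ ⟨m, v, k⟩ h
  simp only [appendLink, Prod.mk.injEq] at h
  obtain ⟨rfl, rfl, h⟩ := h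
  rw [List.append_cancel_right h]

theorem pairCode_appendLink (β : ℕ → ℕ) (y : ℕ → Bool)
    (p q : ℕ × List Bool × List (List ℕ × List Bool)) :
    pairCode (.inl (appendLink β y p)) (.inl (appendLink β y q)) =
      pairCode (.inl p) (.inl q) := by
  have h : (p.1 ≤ q.1 ∧ truncate p.1 (q.2.2 ++ [(initSeg q.1 β, initSeg q.1 y)]) =
      p.2.2 ++ [(initSeg p.1 β, initSeg p.1 y)]) ↔
      (p.1 ≤ q.1 ∧ truncate p.1 q.2.2 = p.2.2) := by
    refine and_congr_right fun hpq => ?_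
    simp only [truncate, List.map_append, List.map_cons, List.map_nil, take_initSeg hpq,
      List.append_left_inj]
  simp only [pairCode, appendLink, h]

/-- A link from `x` to `y` yields a label-preserving map: it is appended to every chain that ends at
`x`, and the vertices not present at `x` go to the reserve. -/
theorem exists_map_of_rangeRel {x y : ℕ → Bool} (h : RangeRel g x y) :
    ∃ γ : ChainVertex → ChainVertex, ∀ u v,
      (chainLabelling (IsPresent g y)).label (γ u) (γ v) =
        (chainLabelling (IsPresent g x)).label u v := by
  classical
  obtain ⟨β, hβ⟩ := h
  let γ : ChainVertex → ChainVertex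
    | .inl p => if IsPresent g x (.inl p) then .inl (appendLink β y p)
        else .inr (2 * Encodable.encode p)
    | .inr k => .inr (2 * k + 1)
  have hpos : ∀ p, IsPresent g x (.inl p) → γ (.inl p) = .inl (appendLink β y p) :=
    fun p hp => if_pos hp
  have hneg : ∀ p, ¬ IsPresent g x (.inl p) → γ (.inl p) = .inr (2 * Encodable.encode p) :=
    fun p hp => if_neg hp
  have hres : ∀ k, γ (.inr k) = .inr (2 * k + 1) := fun k => rfl
  have hinj : Function.Injective γ := by
    rintro (p | k) (q | m) huv
    · by_cases hp : IsPresent g x (.inl p) <;> by_cases hq : IsPresent g x (.inl q)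
      · rw [hpos p hp, hpos q hq] at huv
        rw [appendLink_injective β y (Sum.inl_injective huv)]
      · rw [hpos p hp, hneg q hq] at huv
        cases huv
      · rw [hneg p hp, hpos q hq] at huv
        cases huv
      · rw [hneg p hp, hneg q hq] at huv
        have := Sum.inr_injective huv
        rw [Encodable.encode_injective (show Encodable.encode p = Encodable.encode q by omega)]
    · by_cases hp : IsPresent g x (.inl p)
      · rw [hpos p hp, hres] at huv
        cases huv
      · rw [hneg p hp, hres] at huv
        have := Sum.inr_injective huv
        omega
    · by_cases hq : IsPresent g x (.inl q)
      · rw [hpos q hq, hres] at huv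
        cases huv
      · rw [hneg q hq, hres] at huv
        have := Sum.inr_injective huv
        omega
    · have := Sum.inr_injective huv
      rw [show k = m by omega]
  have hpres : ∀ u, IsPresent g y (γ u) ↔ IsPresent g x u := by
    rintro (p | k)
    · by_cases hp : IsPresent g x (.inl p)
      · rw [hpos p hp]
        exact iff_of_true (IsApproxChain.append_link hβ hp) hp
      · rw [hneg p hp]
        exact iff_of_false id hp
    · exact Iff.rfl
  refine ⟨γ, fun u v => ?_⟩
  simp only [chainLabelling, hinj.eq_iff, hpres]
  split_ifs with h1 h2
  · rfl
  · obtain ⟨hu, hv⟩ := h2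
    rcases u with p | k
    · rcases v with q | m
      · rw [hpos p hu, hpos q hv, pairCode_appendLink]
      · exact hv.elim
    · exact hu.elim
  · rfl

/-- A label-preserving map sends the empty chains at the initial segments of `x`, which are
restrictions of one another, to a coherent sequence of approximations to chains from `x` to `y`. -/
theorem reflTransGen_of_map (hg : Continuous g) {x y : ℕ → Bool} {γ : ChainVertex → ChainVertex}
    (hγ : ∀ u v, (chainLabelling (IsPresent g y)).label (γ u) (γ v) =
      (chainLabelling (IsPresent g x)).label u v) :
    Relation.ReflTransGen (RangeRel g) x y := by
  classical
  let p : ℕ → ChainVertex := fun n => .inl (n, initSeg n x, [])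
  have hp : ∀ n, IsPresent g x (p n) := fun n => rfl
  have hne : ∀ n, p n ≠ p (n + 1) := fun n h => by
    have := congrArg Prod.fst (Sum.inl_injective h)
    simp at this
  have key : ∀ n, (IsPresent g y (γ (p n)) ∧ IsPresent g y (γ (p (n + 1)))) ∧
      pairCode (γ (p n)) (γ (p (n + 1))) = pairCode (p n) (p (n + 1)) := by
    intro n
    have h := hγ (p n) (p (n + 1))
    simp only [chainLabelling, hne n, hp, and_self, if_true, if_false] at h
    split_ifs at h with h1 h2
    · omega
    · exact ⟨h2, by omega⟩
    · omega
  have hform : ∀ n, ∃ q, γ (p n) = .inl q := by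
    intro n
    have h := (key n).1.1
    rcases hq : γ (p n) with q | k
    · exact ⟨q, rfl⟩
    · rw [hq] at h
      exact h.elim
  choose q hq using hform
  have hcode : ∀ n, (q n).1 = n ∧ (q n).2.1 = initSeg n x ∧
      truncate (q n).1 (q (n + 1)).2.2 = (q n).2.2 := by
    intro n
    have h := (key n).2
    rw [hq, hq] at h
    have h' := Encodable.encode_injective h
    simp only [Prod.mk.injEq] at h'
    obtain ⟨⟨h1, h2⟩, -, h3⟩ := h'
    refine ⟨h1, h2, ((decide_eq_decide.1 h3).2 ⟨n.le_succ, rfl⟩).2⟩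
  have hcoh : ∀ n, truncate n (q (n + 1)).2.2 = (q n).2.2 := by
    intro n
    have := (hcode n).2.2
    rwa [(hcode n).1] at this
  refine reflTransGen_of_approxChains hg (q 0).2.2.length x (fun n => (q n).2.2) (fun n => ?_)
    hcoh fun n => ?_
  · induction n with
    | zero => rfl
    | succ n ih =>
      rw [← ih]
      rw [← hcoh n, truncate, List.length_map]
  · have h := (key n).1.1
    rw [hq] at h
    change IsApproxChain g (q n).1 (q n).2.1 (q n).2.2 (initSeg (q n).1 y) at h
    rwa [(hcode n).1, (hcode n).2.1] at h

end Chain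

/-! ### Completeness -/

theorem exists_continuous_rangeRel_iff {Z : Type*} [MeasurableSpace Z] [StandardBorelSpace Z]
    [Nonempty Z] {R : Z → Z → Prop} (hR : IsAnalyticQuasiOrder R) {c : Z → ℕ → Bool}
    (hc : Measurable c) :
    ∃ g : (ℕ → ℕ) → (ℕ → Bool) × (ℕ → Bool), Continuous g ∧
      ∀ x y, RangeRel g x y ↔ ∃ z z', R z z' ∧ c z = x ∧ c z' = y := by
  obtain ⟨Y, _, _, _, _, B, hB, hRB⟩ := hR.analytic
  have hmeas : Measurable fun p : (Z × Z) × Y => (c p.1.1, c p.1.2) := by fun_prop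
  have hA := hB.analyticSet_image hmeas
  have himage : ∀ x y, (x, y) ∈ (fun p : (Z × Z) × Y => (c p.1.1, c p.1.2)) '' B ↔
      ∃ z z', R z z' ∧ c z = x ∧ c z' = y := by
    intro x y
    constructor
    · rintro ⟨⟨⟨z, z'⟩, a⟩, hp, h⟩
      have hz : (z, z') ∈ {p : Z × Z | R p.1 p.2} := hRB ▸ ⟨_, hp, rfl⟩
      exact ⟨z, z', hz, congrArg Prod.fst h, congrArg Prod.snd h⟩
    · rintro ⟨z, z', h, rfl, rfl⟩
      have hz : (z, z') ∈ Prod.fst '' B := hRB ▸ h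
      obtain ⟨p, hp, hpz⟩ := hz
      exact ⟨p, hp, by simp only [hpz]⟩
  rw [AnalyticSet] at hA
  rcases hA with hA | ⟨g, hg, hrange⟩
  · obtain ⟨z⟩ := ‹Nonempty Z›
    have := (himage (c z) (c z)).2 ⟨z, z, hR.refl z, rfl, rfl⟩
    rw [hA] at this
    exact this.elim
  · exact ⟨g, hg, fun x y => by rw [← himage, ← hrange]; rfl⟩

theorem measurable_isPresent {Z : Type*} [MeasurableSpace Z] {c : Z → ℕ → Bool} (hc : Measurable c)
    (g : (ℕ → ℕ) → (ℕ → Bool) × (ℕ → Bool)) (u : ChainVertex) :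
    Measurable fun z => IsPresent g (c z) u := by
  rcases u with p | k
  · exact measurable_initSeg hc p.1 fun w => IsApproxChain g p.1 p.2.1 p.2.2 w
  · exact measurable_const

/-- The copy with domain `ℕ` of the quandle of the labelling of the vertices satisfying `P`. -/
noncomputable def codedChainQuandle (e : ChainVertex × AddCircle (1 : ℚ) ≃ ℕ)
    (P : ChainVertex → Prop) : QuandleSpace :=
  transportQuandle (A := LabelQuandle (chainLabelling P)) e

theorem measurable_codedChainQuandle {Z : Type*} [MeasurableSpace Z]
    (e : ChainVertex × AddCircle (1 : ℚ) ≃ ℕ) {P : Z → ChainVertex → Prop}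
    (hP : ∀ u, Measurable fun z => P z u) : Measurable fun z => codedChainQuandle e (P z) := by
  classical
  rw [QuandleSpace.measurable_iff_code]
  intro x y w
  -- Membership in the graph of the operation depends only on the presence of two vertices.
  let F : Prop × Prop → Prop := fun b =>
    e ((e.symm y).1, (e.symm y).2 + ((1 / ((if (e.symm x).1 = (e.symm y).1 then 1 else
      if b.1 ∧ b.2 then pairCode (e.symm x).1 (e.symm y).1 + 3 else 2 : ℕ) : ℚ) : ℚ) :
        AddCircle (1 : ℚ))) = w
  have hF : (fun z => (codedChainQuandle e (P z)).code x y w) =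
      fun z => F (P z (e.symm x).1, P z (e.symm y).1) := by
    funext z
    change (e ((e.symm y).1, (e.symm y).2 + (chainLabelling (P z)).shift (e.symm x).1
      (e.symm y).1) = w) = _
    simp only [PairLabelling.shift, chainLabelling, F]
  rw [hF]
  exact (measurable_of_countable F).comp ((hP _).prodMk (hP _))

theorem QuandleSpace.exists_isBorelReduction_embeds {Z : Type*} [MeasurableSpace Z]
    [StandardBorelSpace Z] {R : Z → Z → Prop} (hR : IsAnalyticQuasiOrder R) :
    ∃ f : Z → QuandleSpace, IsBorelReduction f R QuandleSpace.Embeds := by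
  rcases isEmpty_or_nonempty Z with hZ | hZ
  · exact ⟨isEmptyElim, measurable_of_empty _, isEmptyElim⟩
  obtain ⟨c, hc, hcinj⟩ :=
    MeasurableSpace.measurable_injection_nat_bool_of_countablySeparated (α := Z)
  obtain ⟨g, hg, hgR⟩ := exists_continuous_rangeRel_iff hR hc
  have : Countable (AddCircle (1 : ℚ)) := Quotient.countable
  obtain ⟨_⟩ := nonempty_denumerable (ChainVertex × AddCircle (1 : ℚ))
  let e := Denumerable.eqv (ChainVertex × AddCircle (1 : ℚ))
  refine ⟨fun z => codedChainQuandle e (IsPresent g (c z)),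
    measurable_codedChainQuandle e (measurable_isPresent hc g), fun z z' => ?_⟩
  have hemb : QuandleSpace.Embeds (codedChainQuandle e (IsPresent g (c z)))
      (codedChainQuandle e (IsPresent g (c z'))) ↔
      QuandleEmbeds (LabelQuandle (chainLabelling (IsPresent g (c z))))
        (LabelQuandle (chainLabelling (IsPresent g (c z')))) :=
    QuandleSpace.embeds_transport_iff
      (A := LabelQuandle (chainLabelling (IsPresent g (c z))))
      (B := LabelQuandle (chainLabelling (IsPresent g (c z')))) e e
  rw [hemb, PairLabelling.quandleEmbeds_iff]
  constructor
  · intro h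
    exact exists_map_of_rangeRel ((hgR _ _).2 ⟨z, z', h, rfl, rfl⟩)
  · rintro ⟨γ, hγ⟩
    have hchain := reflTransGen_of_map hg hγ
    have hlift : ∀ y, Relation.ReflTransGen (RangeRel g) (c z) y → ∃ w, c w = y ∧ R z w := by
      intro y hy
      induction hy with
      | refl => exact ⟨z, rfl, hR.refl z⟩
      | tail _ hstep ih =>
        obtain ⟨w, rfl, hzw⟩ := ih
        obtain ⟨a, b, hab, ha, rfl⟩ := (hgR _ _).1 hstep
        rw [hcinj ha] at hab
        exact ⟨b, rfl, hR.trans _ _ _ hzw hab⟩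
    obtain ⟨w, hw, hzw⟩ := hlift _ hchain
    rwa [hcinj hw] at hzw

/-! ### Quandles of graphs -/

/-- If no vertex of `G` is adjacent to all others, an injective homomorphism of graph quandles maps
fibres onto fibres: the other point of a fibre is the result of acting by a non-adjacent vertex. -/
theorem quandleEmbeds_graphQuandle_iff (G H : SimpleGraph ℕ)
    (hG : ∀ x, ∃ y, x ≠ y ∧ ¬ G.Adj x y) :
    QuandleEmbeds (GraphQuandle G) (GraphQuandle H) ↔ Nonempty (G ↪g H) := by
  classical
  constructor
  · rintro ⟨⟨f, hf⟩, hinj⟩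
    let f' : ℕ × Fin 2 → ℕ × Fin 2 := f
    have hf' : ∀ p q, f' (GraphQuandle.op G p q) = GraphQuandle.op H (f' p) (f' q) :=
      fun p q => @hf p q
    have hinj' : Function.Injective f' := hinj
    have op_fst : ∀ (T : SimpleGraph ℕ) (p q : ℕ × Fin 2), (GraphQuandle.op T p q).1 = q.1 := by
      intro T p q
      unfold GraphQuandle.op
      split_ifs <;> rfl
    have op_eq : ∀ (T : SimpleGraph ℕ) (p q : ℕ × Fin 2),
        GraphQuandle.op T p q = q ↔ p.1 = q.1 ∨ T.Adj p.1 q.1 := by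
      rintro T ⟨u, i⟩ ⟨v, j⟩
      by_cases h : u = v ∨ T.Adj u v
      · simp [GraphQuandle.op, h]
      · simp only [GraphQuandle.op, h, if_false, Prod.mk.injEq, true_and, iff_false]
        fin_cases j <;> decide
    have fibre : ∀ v j, (f' (v, j)).1 = (f' (v, 0)).1 := by
      intro v j
      obtain ⟨u, huv, hadj⟩ := hG v
      have hne : ¬ (u = v ∨ G.Adj u v) := by
        rintro (h | h)
        exacts [huv h.symm, hadj h.symm]
      have h : GraphQuandle.op G (u, 0) (v, 0) = (v, 1) := by
        simp only [GraphQuandle.op, hne, if_false]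
        rfl
      have h1 : (f' (v, 1)).1 = (f' (v, 0)).1 := by rw [← h, hf', op_fst]
      fin_cases j
      exacts [rfl, h1]
    let γ : ℕ → ℕ := fun v => (f' (v, 0)).1
    have hγ : Function.Injective γ := by
      -- The three points `(u, 0)`, `(u, 1)`, `(v, 0)` cannot all map into a fibre of size two.
      intro u v huv
      have h0 : (f' (u, 0)).1 = (f' (v, 0)).1 := huv
      have h1 := fibre u 1
      have two : ∀ a b c : Fin 2, a ≠ b → c = a ∨ c = b := by decide
      have hne : (f' (u, 0)).2 ≠ (f' (u, 1)).2 := fun h => by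
        simpa using hinj' (Prod.ext h1.symm h)
      rcases two _ _ (f' (v, 0)).2 hne with h | h
      · exact (congrArg Prod.fst (hinj' (Prod.ext h0.symm h))).symm
      · exact (congrArg Prod.fst (hinj' (Prod.ext (h0.symm.trans h1.symm) h))).symm
    refine ⟨⟨⟨γ, hγ⟩, fun {u v} => ?_⟩⟩
    change H.Adj (γ u) (γ v) ↔ G.Adj u v
    have h : GraphQuandle.op H (f' (u, 0)) (f' (v, 0)) = f' (v, 0) ↔
        GraphQuandle.op G (u, 0) (v, 0) = (v, 0) := by
      rw [← hf', hinj'.eq_iff]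
    rw [op_eq, op_eq] at h
    change (γ u = γ v ∨ H.Adj (γ u) (γ v)) ↔ (u = v ∨ G.Adj u v) at h
    rw [hγ.eq_iff] at h
    by_cases huv : u = v
    · subst huv
      simp
    · simpa [huv] using h
  · rintro ⟨φ⟩
    refine ⟨⟨fun p => (φ p.1, p.2), fun {p q} => ?_⟩, ?_⟩
    · change (φ (GraphQuandle.op G p q).1, (GraphQuandle.op G p q).2) =
        GraphQuandle.op H (φ p.1, p.2) (φ q.1, q.2)
      by_cases h : p.1 = q.1 ∨ G.Adj p.1 q.1 <;>
        simp only [GraphQuandle.op, h, φ.injective.eq_iff, φ.map_adj_iff, if_true, if_false]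
    · rintro ⟨u, i⟩ ⟨v, j⟩ h
      have h1 : φ u = φ v := congrArg Prod.fst h
      have h2 : i = j := congrArg Prod.snd h
      rw [φ.injective h1, h2]

theorem measurable_codedGraphQuandle (e : ℕ × Fin 2 ≃ ℕ) :
    Measurable fun T : TreeSpace => codedGraphQuandle e T.1 := by
  classical
  rw [QuandleSpace.measurable_iff_code]
  intro x y z
  have hadj : Measurable fun T : TreeSpace => T.1.Adj (e.symm x).1 (e.symm y).1 :=
    SimpleGraph.measurable_iff_adj.1 measurable_subtype_coe _ _
  -- Membership in the graph of the operation depends on a single adjacency.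
  let F : Prop → Prop := fun b =>
    e (if (e.symm x).1 = (e.symm y).1 ∨ b then ((e.symm y).1, (e.symm y).2)
      else ((e.symm y).1, (e.symm y).2 - 1)) = z
  have hF : (fun T : TreeSpace => (codedGraphQuandle e T.1).code x y z) =
      fun T => F (T.1.Adj (e.symm x).1 (e.symm y).1) := by
    funext T
    change (e (GraphQuandle.op T.1 (e.symm x) (e.symm y)) = z) = _
    simp only [GraphQuandle.op, F]
  rw [hF]
  exact (measurable_of_countable F).comp hadj

theorem mainTheorem3 :
    IsCompleteAnalyticQuasiOrder.{u, 0} QuandleSpace.Embeds ∧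
    (∀ S T : TreeSpace,
      S.Embeds T ↔ QuandleEmbeds (GraphQuandle S.1) (GraphQuandle T.1)) ∧
    (∀ e : ℕ × Fin 2 ≃ ℕ,
      IsBorelReduction (fun T : TreeSpace => codedGraphQuandle e T.1)
        TreeSpace.Embeds QuandleSpace.Embeds) := by
  refine ⟨⟨QuandleSpace.isAnalyticQuasiOrder_embeds, fun Z _ _ P hP =>
    QuandleSpace.exists_isBorelReduction_embeds hP⟩, fun S T =>
    (quandleEmbeds_graphQuandle_iff S.1 T.1 S.2.2).symm, fun e =>
    ⟨measurable_codedGraphQuandle e, fun S T => ?_⟩⟩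
  have h : QuandleSpace.Embeds (codedGraphQuandle e S.1) (codedGraphQuandle e T.1) ↔
      QuandleEmbeds (GraphQuandle S.1) (GraphQuandle T.1) :=
    QuandleSpace.embeds_transport_iff (A := GraphQuandle S.1) (B := GraphQuandle T.1) e e
  exact (quandleEmbeds_graphQuandle_iff S.1 T.1 S.2.2).symm.trans h.symm
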